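/- Fix $\alpha>0$. For every integer $N\ge 1$ let $\Lambda_N=\{1,\dots,N\}$ and let $M=M_N$ be a positive integer equal to $N^{1+\alpha}$ up to rounding, i.e. $|M_N-N^{1+\alpha}|<1$. Consider the Markov process $\omega(t)=(\eta(\cdot,t),n_-(t),n_+(t))$ on $\{0,1\}^{\Lambda_N}\times\{0,\dots,M\}\times\{0,\dots,M\}$ with generator $$\mathbf L f(\omega)=\tfrac12\sum_{x=1}^{N-1}[f(\omega^{x,x+1})-f(\omega)]+c_N(\omega)[f(\omega^N)-f(\omega)]+c_1(\omega)[f(\omega^1)-f(\omega)],$$ where $\omega^{x,x+1}$ is obtained from $\omega$ by exchanging $\eta(x)$ and $\eta(x+1)$, $$c_N(\omega)=\tfrac12\Big(1-\frac{n_+}{M}\Big)\eta(N)+\tfrac12\,\frac{n_+}{M}\,(1-\eta(N)),\qquad c_1(\omega)=\tfrac12\Big(1-\frac{n_-}{M}\Big)\eta(1)+\tfrac12\,\frac{n_-}{M}\,(1-\eta(1)),$$ $\omega^N$ is obtained from $\omega$ by replacing $(\eta(N),n_+)$ by $(0,n_++1)$ if $\eta(N)=1$ and by $(1,n_+-1)$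 if $\eta(N)=0$, and $\omega^1$ is obtained likewise from $(\eta(1),n_-)$. Its law and expectation are denoted by $\mathbf P^N$ and $\mathbf E^N$. Let $v_{0,-},v_{0,+}\in[0,1]$, and let $u_0:(0,1]\to[0,1]$ be continuous on $(0,1)$. Assume that at time $0$ $$\mathbf P^N\Big(\Big|\frac{n_\pm(0)}{M_N}-v_{0,\pm}\Big|\ge\delta\Big)\xrightarrow[N\to\infty]{}0\quad\text{for every }\delta>0,\qquad \mathbf E^N[\eta(x,0)]=u_0(x/N)\quad\text{for all } N\ge 1,\ x\in\Lambda_N .$$ Let $\mathcal E^N$ denote the expectation with respect to the symmetric simple exclusion process on $\{0,1\}^{\Lambda_N}$ with ideal reservoirs of fixed densities $v_{0,\pm}$, i.e. the Markov process with generator $$\mathcal L f(\eta)=\tfrac12\sum_{x=1}^{N-1}[f(\eta^{x,x+1})-f(\eta)]+\tfrac12\big[(1-v_{0,+})\eta(N)+v_{0,+}(1-\eta(N))\big][f(\eta^{N})-f(\eta)]+\tfrac12\big[(1-v_{0,-})\eta(1)+v_{0,-}(1-\eta(1))\big][f(\eta^{1})-f(\eta)],$$ where $\eta^{x,x+1}$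 is obtained from $\eta$ by exchanging $\eta(x)$ and $\eta(x+1)$, and $\eta^{x}$ by replacing $\eta(x)$ by $1-\eta(x)$, started from any initial distribution with $\mathcal E^N[\eta(x,0)]=u_0(x/N)$ for all $x\in\Lambda_N$. Then for every $\alpha'\in[0,\alpha)$ and every $T>0$, $$\lim_{N\to\infty}\ \sup_{x\in\Lambda_N}\ \sup_{t\in[0,T]}\Big|\mathbf E^N\big[\eta(x,N^{2+\alpha'}t)\big]-\mathcal E^N\big[\eta(x,N^{2+\alpha'}t)\big]\Big|=0 .$$ -/

import Mathlib

open MeasureTheory Filter Topology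
open scoped NNReal ENNReal

noncomputable section

/-! ### Markov processes on a finite state space -/

/-- The semigroup `exp (t L)` generated by a linear operator `L` on the (finite-dimensional) space
of functions on a finite set `S`. -/
def markovSemigroup {S : Type*} [Fintype S] (L : (S → ℝ) →ₗ[ℝ] (S → ℝ)) (t : ℝ≥0) :
    (S → ℝ) →L[ℝ] (S → ℝ) :=
  NormedSpace.exp ((t : ℝ) • LinearMap.toContinuousLinearMap L)

/-- The σ-algebra generated by the process up to (and including) time `s`. -/
abbrev pastSigma {Ω S : Type*} [MeasurableSpace S] (X : ℝ≥0 → Ω → S) (s : ℝ≥0) :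
    MeasurableSpace Ω :=
  ⨆ u : Set.Iic s, MeasurableSpace.comap (X u) inferInstance

/-- `X` is, under `P`, a Markov process with generator `L` on the finite state space `S`
(with arbitrary initial distribution):
`E[f(X_{s+t}) | σ(X_u, u ≤ s)] = (exp(tL) f)(X_s)` almost surely. -/
structure IsMarkovProcess {Ω S : Type*} [MeasurableSpace Ω] [Fintype S] [MeasurableSpace S]
    (L : (S → ℝ) →ₗ[ℝ] (S → ℝ)) (P : Measure Ω) (X : ℝ≥0 → Ω → S) : Prop where
  measurable : ∀ t, Measurable (X t)
  markov : ∀ (s t : ℝ≥0) (f : S → ℝ),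
    P[fun ω => f (X (s + t) ω) | pastSigma X s] =ᵐ[P]
      fun ω => markovSemigroup L t f (X s ω)

/-! ### The channel

The channel `{1, …, N}` with `N = n + 1` sites is indexed by `Fin (n + 1)`:
the index `x` stands for the site `x + 1`, so `0` is the site `1` and `Fin.last n` the site `N`. -/

/-- Particle configurations in the channel with `n + 1` sites. -/
abbrev Config (n : ℕ) := Fin (n + 1) → Bool

/-- The number `η(x) ∈ {0, 1}` of particles at a site, as a real number. -/
def occ {n : ℕ} (η : Config n) (x : Fin (n + 1)) : ℝ := if η x then 1 else 0

/-- The configuration in which the contents of the sites `x` and `y` are exchanged. -/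
def exchange {n : ℕ} (x y : Fin (n + 1)) (η : Config n) : Config n :=
  fun z => η (Equiv.swap x y z)

/-- The configuration in which the occupation of the site `x` is flipped. -/
def flipAt {n : ℕ} (x : Fin (n + 1)) (η : Config n) : Config n :=
  Function.update η x (!(η x))

/-- The rate at which a site holding `a ∈ {0, 1}` particles is flipped by a reservoir of
density `v`: a particle leaves at rate `(1 - v) / 2` and enters at rate `v / 2`. -/
def boundaryRate (v a : ℝ) : ℝ := 1 / 2 * (1 - v) * a + 1 / 2 * v * (1 - a)

/-! ### The exclusion process coupled to two finite reservoirs -/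

/-- The state space `{0,1}^N × {0,…,M} × {0,…,M}` of triples `(η, n₋, n₊)`. -/
abbrev State (n M : ℕ) := Config n × Fin (M + 1) × Fin (M + 1)

/-- The density `n₋ / M` of the left reservoir. -/
def leftDensity {n M : ℕ} (ω : State n M) : ℝ := ((ω.2.1 : ℕ) : ℝ) / M

/-- The density `n₊ / M` of the right reservoir. -/
def rightDensity {n M : ℕ} (ω : State n M) : ℝ := ((ω.2.2 : ℕ) : ℝ) / M

/-- The new particle number of a reservoir holding `k` particles, after the exchange of a particle
with the adjacent site: `k + 1` if that site was occupied, `k - 1` if it was empty.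
(The truncation at `0` and `M` only concerns transitions of rate zero.) -/
def reservoirUpdate {M : ℕ} (occupied : Bool) (k : Fin (M + 1)) : Fin (M + 1) :=
  if occupied then ⟨min M (k + 1), by omega⟩ else ⟨k - 1, by omega⟩

/-- The state `ω¹`: a particle is exchanged between the site `1` and the left reservoir. -/
def leftMove {n M : ℕ} (ω : State n M) : State n M :=
  (flipAt 0 ω.1, reservoirUpdate (ω.1 0) ω.2.1, ω.2.2)

/-- The state `ω^N`: a particle is exchanged between the site `N` and the right reservoir. -/
def rightMove {n M : ℕ} (ω : State n M) : State n M :=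
  (flipAt (Fin.last n) ω.1, ω.2.1, reservoirUpdate (ω.1 (Fin.last n)) ω.2.2)

/-- The generator of the symmetric simple exclusion process in a channel of `n + 1` sites coupled
in mean-field fashion to two reservoirs of size `M`. -/
def reservoirGenerator (n M : ℕ) : (State n M → ℝ) →ₗ[ℝ] (State n M → ℝ) where
  toFun f ω :=
    1 / 2 * ∑ x : Fin n, (f (exchange x.castSucc x.succ ω.1, ω.2) - f ω)
      + boundaryRate (rightDensity ω) (occ ω.1 (Fin.last n)) * (f (rightMove ω) - f ω)
      + boundaryRate (leftDensity ω) (occ ω.1 0) * (f (leftMove ω) - f ω)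
  map_add' f g := by
    funext ω
    simp only [Pi.add_apply, Finset.sum_sub_distrib, Finset.sum_add_distrib]
    ring
  map_smul' c f := by
    funext ω
    simp only [Pi.smul_apply, smul_eq_mul, RingHom.id_apply, ← mul_sub, ← Finset.mul_sum]
    ring

/-! ### The exclusion process with ideal reservoirs -/

/-- The generator of the symmetric simple exclusion process in a channel of `n + 1` sites with
ideal reservoirs (birth-death processes at the end sites) of fixed densities `vl` (left)
and `vr` (right). -/
def idealGenerator (n : ℕ) (vl vr : ℝ) : (Config n → ℝ) →ₗ[ℝ] (Config n → ℝ) where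
  toFun f η :=
    1 / 2 * ∑ x : Fin n, (f (exchange x.castSucc x.succ η) - f η)
      + boundaryRate vr (occ η (Fin.last n)) * (f (flipAt (Fin.last n) η) - f η)
      + boundaryRate vl (occ η 0) * (f (flipAt 0 η) - f η)
  map_add' f g := by
    funext η
    simp only [Pi.add_apply, Finset.sum_sub_distrib, Finset.sum_add_distrib]
    ring
  map_smul' c f := by
    funext η
    simp only [Pi.smul_apply, smul_eq_mul, RingHom.id_apply, ← mul_sub, ← Finset.mul_sum]
    ring

end

/-!
The mean occupation numbers of both processes solve the discrete heat equation in the channel; they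
differ only in the boundary values, which are the mean reservoir densities in one case and the
constants `vl`, `vr` in the other. By the maximum principle the two solutions therefore stay as
close as the boundary values do. The reservoir densities move slowly: for weights `c` that are
affine in the site, the number of particles in channel and reservoirs, counted with weights `c`,
has a drift equal to half the slope of `c` times the difference of the reservoir densities.
Weights falling from `1` to `0` across the channel isolate the left reservoir, weights rising from
`0` to `1` the right one. In both cases the slope is of order `1 / N` and the channel carries at
most `N` particles, so up to time `t` a mean reservoir density changes by at most
`(N + t / N) / M`, which vanishes in the limit as long as `N ≪ M` and `t ≪ N * M`.
-/

/-! ### Expectations along a Markov process -/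

section MarkovProcess

variable {Ω S : Type*} [MeasurableSpace Ω] [MeasurableSpace S] [MeasurableSingletonClass S]

theorem integrable_comp_of_finite [Finite S] {P : Measure Ω} [IsFiniteMeasure P] {Z : Ω → S}
    (hZ : Measurable Z) (f : S → ℝ) : Integrable (fun ω => f (Z ω)) P :=
  (Integrable.of_finite (f := f) (μ := P.map Z)).comp_measurable hZ

/-- The expectation under `P` of an observable of the finitely-valued random variable `Z`, as a
continuous linear functional of the observable. -/
noncomputable def expectation [Finite S] (P : Measure Ω) [IsFiniteMeasure P] {Z : Ω → S}
    (hZ : Measurable Z) : (S → ℝ) →L[ℝ] ℝ :=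
  LinearMap.toContinuousLinearMap
    { toFun f := ∫ ω, f (Z ω) ∂P
      map_add' f g :=
        integral_add (integrable_comp_of_finite hZ f) (integrable_comp_of_finite hZ g)
      map_smul' c f := integral_const_mul c fun ω => f (Z ω) }

namespace IsMarkovProcess

variable [Fintype S] {L : (S → ℝ) →ₗ[ℝ] (S → ℝ)} {P : Measure Ω} {X : ℝ≥0 → Ω → S}

/-- The expectation of an observable at time `t`, as a functional of the observable. It is computed
from the law at time `0` and the semigroup, so that it makes sense, and is smooth, for all real
`t`; only for `t ≥ 0` is it the expectation of an observable of the process. -/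
noncomputable def mean [IsFiniteMeasure P] (hX : IsMarkovProcess L P X) (t : ℝ) :
    (S → ℝ) →L[ℝ] ℝ :=
  expectation P (hX.measurable 0) ∘L NormedSpace.exp (t • LinearMap.toContinuousLinearMap L)

theorem integral_eq_mean [IsFiniteMeasure P] (hX : IsMarkovProcess L P X) (f : S → ℝ) (t : ℝ≥0) :
    ∫ ω, f (X t ω) ∂P = hX.mean t f := by
  have hpast : pastSigma X 0 ≤ (inferInstance : MeasurableSpace Ω) :=
    iSup_le fun u => (hX.measurable u).comap_le
  have h := integral_congr_ae (hX.markov 0 t f)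
  rw [integral_condExp hpast, zero_add] at h
  exact h

theorem hasDerivAt_mean [IsFiniteMeasure P] (hX : IsMarkovProcess L P X) (f : S → ℝ) (t : ℝ) :
    HasDerivAt (fun s => hX.mean s f) (hX.mean t (L f)) t := by
  have hexp := hasDerivAt_exp_smul_const (𝕂 := ℝ) (LinearMap.toContinuousLinearMap L) t
  have h := (expectation P (hX.measurable 0)).hasFDerivAt.comp_hasDerivAt t
    (hexp.clm_apply (hasDerivAt_const t f))
  exact h.congr_deriv (by simp [mean])

variable [IsProbabilityMeasure P]

theorem mean_mem_Icc (hX : IsMarkovProcess L P X) {f : S → ℝ} {a b : ℝ}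
    (hf : ∀ s, f s ∈ Set.Icc a b) {t : ℝ} (ht : 0 ≤ t) : hX.mean t f ∈ Set.Icc a b := by
  lift t to ℝ≥0 using ht
  have hi := integrable_comp_of_finite (P := P) (hX.measurable t) f
  rw [← hX.integral_eq_mean]
  constructor
  · simpa using integral_mono (integrable_const a) hi fun ω => (hf _).1
  · simpa using integral_mono hi (integrable_const b) fun ω => (hf _).2

theorem mean_const (hX : IsMarkovProcess L P X) (c : ℝ) {t : ℝ} (ht : 0 ≤ t) :
    hX.mean t (fun _ => c) = c := by
  simpa using hX.mean_mem_Icc (f := fun _ => c) (a := c) (b := c) (by simp) ht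

theorem abs_mean_sub_mean_zero_le (hX : IsMarkovProcess L P X) {f : S → ℝ} {C : ℝ}
    (hf : ∀ s, |L f s| ≤ C) {t : ℝ} (ht : 0 ≤ t) : |hX.mean t f - hX.mean 0 f| ≤ C * t := by
  have h := (convex_Icc (0 : ℝ) t).norm_image_sub_le_of_norm_hasDerivWithin_le
    (fun s _ => (hX.hasDerivAt_mean f s).hasDerivWithinAt)
    (fun s hs => abs_le.2 (hX.mean_mem_Icc (fun x => abs_le.1 (hf x)) hs.1))
    (Set.left_mem_Icc.2 ht) (Set.right_mem_Icc.2 ht)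
  simpa [abs_of_nonneg ht] using h

end IsMarkovProcess

end MarkovProcess

/-! ### The maximum principle for the discrete heat equation -/

/-- The second difference (discrete Laplacian) of a sequence. Its value with index `k` is the one
centred at `k + 1`, which avoids a subtraction of natural numbers. -/
def secondDiff {E : Type*} [AddCommGroup E] (a : ℕ → E) (k : ℕ) : E :=
  (a (k + 2) - a (k + 1)) - (a (k + 1) - a k)

theorem map_secondDiff {E F G : Type*} [AddCommGroup E] [AddCommGroup F] [FunLike G E F]
    [AddMonoidHomClass G E F] (φ : G) (a : ℕ → E) (k : ℕ) :
    φ (secondDiff a k) = secondDiff (fun j => φ (a j)) k := by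
  simp only [secondDiff, map_sub]

theorem sum_secondDiff {E : Type*} [AddCommGroup E] (a : ℕ → E) (m : ℕ) :
    ∑ k ∈ Finset.range m, secondDiff a k = (a (m + 1) - a m) - (a 1 - a 0) :=
  Finset.sum_range_sub (fun k => a (k + 1) - a k) m

/-- Summation by parts; affine weights are those whose own second difference vanishes. -/
theorem sum_affine_mul_secondDiff {R : Type*} [CommRing R] (p q : R) (a : ℕ → R) (m : ℕ) :
    ∑ k ∈ Finset.range m, (p + q * (k + 1)) * secondDiff a k
      = (p + q * m) * a (m + 1) - (p + q * (m + 1)) * a m - p * a 1 + (p + q) * a 0 := by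
  induction m with
  | zero => simp only [Finset.range_zero, Finset.sum_empty]; push_cast; ring
  | succ m ih => rw [Finset.sum_range_succ, ih, secondDiff]; push_cast; ring

theorem posPart_mul_self_eq_sq (x : ℝ) : x⁺ * x = x⁺ ^ 2 := by
  rcases le_total x 0 with h | h
  · simp [posPart_eq_zero.2 h]
  · simp [posPart_eq_self.2 h, sq]

theorem hasDerivAt_posPart_sq (x : ℝ) : HasDerivAt (fun y : ℝ => y⁺ ^ 2) (2 * x⁺) x := by
  refine .of_isLittleO (Asymptotics.IsBigO.trans_isLittleO (.of_bound 1 (.of_forall fun y => ?_))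
    (Asymptotics.isLittleO_pow_sub_sub x one_lt_two))
  have hrem : y⁺ ^ 2 - x⁺ ^ 2 - (y - x) * (2 * x⁺) = (y⁺ - x⁺) ^ 2 + 2 * (x⁺ * (y⁺ - y)) := by
    linear_combination 2 * posPart_mul_self_eq_sq x
  rw [smul_eq_mul, hrem, Real.norm_eq_abs, abs_of_nonneg, one_mul, norm_pow, norm_norm,
    Real.norm_eq_abs, sq_abs]
  · rcases le_total x 0 with hx | hx <;> rcases le_total y 0 with hy | hy <;>
      simp only [posPart_eq_zero.2, posPart_eq_self.2, hx, hy] <;> nlinarith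
  · have := mul_nonneg (posPart_nonneg x) (sub_nonneg.2 (le_posPart y))
    positivity

theorem posPart_mul_secondDiff_le (z : ℕ → ℝ) (k : ℕ) :
    2 * (z (k + 1))⁺ * secondDiff z k ≤ secondDiff (fun j => (z j)⁺ ^ 2) k := by
  have hleft := mul_le_mul_of_nonneg_left (le_posPart (z k)) (posPart_nonneg (z (k + 1)))
  have hright := mul_le_mul_of_nonneg_left (le_posPart (z (k + 2))) (posPart_nonneg (z (k + 1)))
  simp only [secondDiff]
  nlinarith [posPart_mul_self_eq_sq (z (k + 1)), sq_nonneg ((z (k + 1))⁺ - (z k)⁺),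
    sq_nonneg ((z (k + 1))⁺ - (z (k + 2))⁺)]

theorem sum_posPart_mul_secondDiff_nonpos {z : ℕ → ℝ} {m : ℕ} (hleft : z 0 ≤ 0)
    (hright : z (m + 1) ≤ 0) :
    ∑ k ∈ Finset.range m, 2 * (z (k + 1))⁺ * secondDiff z k ≤ 0 :=
  calc ∑ k ∈ Finset.range m, 2 * (z (k + 1))⁺ * secondDiff z k
      ≤ ∑ k ∈ Finset.range m, secondDiff (fun j => (z j)⁺ ^ 2) k :=
        Finset.sum_le_sum fun k _ => posPart_mul_secondDiff_le z k
    _ = -((z m)⁺ ^ 2 + (z 1)⁺ ^ 2) := by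
        rw [sum_secondDiff, posPart_eq_zero.2 hleft, posPart_eq_zero.2 hright]; ring
    _ ≤ 0 := by have := sq_nonneg (z m)⁺; have := sq_nonneg (z 1)⁺; linarith

section MaximumPrinciple

variable {m : ℕ} {D B T : ℝ} {w : ℕ → ℝ → ℝ}

theorem heat_le_of_boundary_le (hD : 0 ≤ D)
    (hw : ∀ k < m, ∀ t ∈ Set.Icc 0 T,
      HasDerivWithinAt (w (k + 1)) (D * secondDiff (fun j => w j t) k) (Set.Icc 0 T) t)
    (hleft : ∀ t ∈ Set.Icc 0 T, w 0 t ≤ B) (hright : ∀ t ∈ Set.Icc 0 T, w (m + 1) t ≤ B)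
    (hinit : ∀ k < m, w (k + 1) 0 ≤ B) {k : ℕ} (hk : k < m) {t : ℝ} (ht : t ∈ Set.Icc 0 T) :
    w (k + 1) t ≤ B := by
  -- The energy of the excess over `B` vanishes initially and does not increase.
  let energy : ℝ → ℝ := fun s => ∑ k ∈ Finset.range m, (w (k + 1) s - B)⁺ ^ 2
  have hderiv : ∀ s ∈ Set.Icc 0 T, HasDerivWithinAt energy (D * ∑ k ∈ Finset.range m,
      2 * (w (k + 1) s - B)⁺ * secondDiff (fun j => w j s - B) k) (Set.Icc 0 T) s := by
    intro s hs
    rw [Finset.mul_sum]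
    refine HasDerivWithinAt.fun_sum fun k hk => ?_
    have h := (hasDerivAt_posPart_sq (w (k + 1) s - B)).comp_hasDerivWithinAt s
      ((hw k (Finset.mem_range.1 hk) s hs).sub_const B)
    refine h.congr_deriv ?_
    simp only [secondDiff]
    ring
  have hanti : AntitoneOn energy (Set.Icc 0 T) := by
    refine antitoneOn_of_hasDerivWithinAt_nonpos (convex_Icc 0 T)
      (fun s hs => (hderiv s hs).continuousWithinAt)
      (fun s hs => (hderiv s (interior_subset hs)).mono interior_subset) fun s hs => ?_
    have hs' := interior_subset hs
    exact mul_nonpos_of_nonneg_of_nonpos hD (sum_posPart_mul_secondDiff_nonpos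
      (z := fun j => w j s - B) (sub_nonpos.2 (hleft s hs')) (sub_nonpos.2 (hright s hs')))
  have henergy_zero : energy 0 = 0 := Finset.sum_eq_zero fun k hk => by
    rw [posPart_eq_zero.2 (sub_nonpos.2 (hinit k (Finset.mem_range.1 hk))), zero_pow two_ne_zero]
  have hsq : (w (k + 1) t - B)⁺ ^ 2 ≤ 0 :=
    calc (w (k + 1) t - B)⁺ ^ 2 ≤ energy t :=
          Finset.single_le_sum (f := fun k => (w (k + 1) t - B)⁺ ^ 2)
            (fun _ _ => sq_nonneg _) (Finset.mem_range.2 hk)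
      _ ≤ energy 0 := hanti (Set.left_mem_Icc.2 (ht.1.trans ht.2)) ht ht.1
      _ = 0 := henergy_zero
  exact sub_nonpos.1 (posPart_eq_zero.1 (sq_nonpos_iff _ |>.1 hsq))

theorem abs_heat_le_of_boundary_le (hD : 0 ≤ D)
    (hw : ∀ k < m, ∀ t ∈ Set.Icc 0 T,
      HasDerivWithinAt (w (k + 1)) (D * secondDiff (fun j => w j t) k) (Set.Icc 0 T) t)
    (hleft : ∀ t ∈ Set.Icc 0 T, |w 0 t| ≤ B) (hright : ∀ t ∈ Set.Icc 0 T, |w (m + 1) t| ≤ B)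
    (hinit : ∀ k < m, |w (k + 1) 0| ≤ B) {k : ℕ} (hk : k < m) {t : ℝ} (ht : t ∈ Set.Icc 0 T) :
    |w (k + 1) t| ≤ B := by
  simp only [abs_le'] at hleft hright hinit ⊢
  refine ⟨heat_le_of_boundary_le hD hw (fun s hs => (hleft s hs).1) (fun s hs => (hright s hs).1)
    (fun j hj => (hinit j hj).1) hk ht, ?_⟩
  refine heat_le_of_boundary_le (w := -w) hD (fun j hj s hs => ?_) (fun s hs => (hleft s hs).2)
    (fun s hs => (hright s hs).2) (fun j hj => (hinit j hj).2) hk ht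
  refine (hw j hj s hs).neg.congr_deriv ?_
  simp only [secondDiff, Pi.neg_apply]
  ring

end MaximumPrinciple

/-! ### The generators on occupation numbers and reservoir densities -/

section Profile

variable {n : ℕ} (l r : ℝ)

theorem occ_mem_Icc (η : Config n) (x : Fin (n + 1)) : occ η x ∈ Set.Icc (0 : ℝ) 1 := by
  unfold occ; split_ifs <;> simp

/-- The density profile as a sequence of observables of the channel: the occupation numbers at the
sites `1, …, n + 1`, extended by the reservoir densities `l` at `0` and `r` beyond `n + 1`. -/
noncomputable def profile : ℕ → Config n → ℝ
  | 0, _ => l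
  | k + 1, η => if h : k < n + 1 then occ η ⟨k, h⟩ else r

theorem profile_site (x : Fin (n + 1)) (η : Config n) : profile l r (x + 1) η = occ η x :=
  dif_pos x.2

theorem profile_last (η : Config n) : profile l r (n + 2) η = r := by
  simp [profile]

theorem profile_mem_Icc {l r : ℝ} (hl : l ∈ Set.Icc (0 : ℝ) 1) (hr : r ∈ Set.Icc (0 : ℝ) 1)
    (k : ℕ) (η : Config n) : profile l r k η ∈ Set.Icc (0 : ℝ) 1 := by
  cases k with
  | zero => exact hl
  | succ k => simp only [profile]; split_ifs; exacts [occ_mem_Icc _ _, hr]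

theorem occ_exchange_sub (η : Config n) (y : Fin n) (x : Fin (n + 1)) :
    occ (exchange y.castSucc y.succ η) x - occ η x
      = (if x = y.castSucc then occ η y.succ - occ η x else 0)
        + (if x = y.succ then occ η y.castSucc - occ η x else 0) := by
  have hne : y.castSucc ≠ y.succ := Fin.castSucc_lt_succ.ne
  by_cases hcast : x = y.castSucc
  · subst hcast; simp [occ, exchange, hne]
  by_cases hsucc : x = y.succ
  · subst hsucc; simp [occ, exchange, hne.symm]
  · simp [occ, exchange, hcast, hsucc, Equiv.swap_apply_of_ne_of_ne hcast hsucc]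

theorem boundaryRate_mul_occ_flipAt_sub (v : ℝ) (η : Config n) (y x : Fin (n + 1)) :
    boundaryRate v (occ η y) * (occ (flipAt y η) x - occ η x)
      = if x = y then 1 / 2 * (v - occ η x) else 0 := by
  by_cases h : x = y
  · subst h
    have hflip : occ (flipAt x η) x = 1 - occ η x := by cases hx : η x <;> simp [occ, flipAt, hx]
    have hsq : occ η x * occ η x = occ η x := by simp [occ]
    rw [if_pos rfl, hflip, boundaryRate]
    linear_combination (2 * v - 1) * hsq
  · simp [occ, flipAt, h]

theorem sum_occ_succ_sub_add_boundary (η : Config n) (x : Fin (n + 1)) :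
    (∑ y : Fin n, if x = y.castSucc then occ η y.succ - occ η x else 0)
      + (if x = Fin.last n then r - occ η x else 0) = profile l r (x + 2) η - occ η x := by
  induction x using Fin.lastCases with
  | last => simp [profile, (Fin.castSucc_lt_last _).ne']
  | cast x => simpa [(Fin.castSucc_lt_last x).ne] using (profile_site l r x.succ η).symm

theorem sum_occ_castSucc_sub_add_boundary (η : Config n) (x : Fin (n + 1)) :
    (∑ y : Fin n, if x = y.succ then occ η y.castSucc - occ η x else 0)
      + (if x = 0 then l - occ η x else 0) = profile l r x η - occ η x := by
  induction x using Fin.cases with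
  | zero => simp [profile, (Fin.succ_ne_zero _).symm]
  | succ x => simpa using (profile_site l r x.castSucc η).symm

theorem idealGenerator_occ (x : Fin (n + 1)) :
    idealGenerator n l r (fun η => occ η x) = (1 / 2 : ℝ) • secondDiff (profile l r) x := by
  funext η
  have hright := sum_occ_succ_sub_add_boundary l r η x
  have hleft := sum_occ_castSucc_sub_add_boundary l r η x
  simp only [idealGenerator, LinearMap.coe_mk, AddHom.coe_mk, occ_exchange_sub,
    boundaryRate_mul_occ_flipAt_sub, Finset.sum_add_distrib, secondDiff, Pi.smul_apply,
    Pi.sub_apply, smul_eq_mul, profile_site]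
  split_ifs at hleft hright ⊢ <;> linarith

theorem idealGenerator_profile {k : ℕ} (hk : k < n + 1) :
    idealGenerator n l r (profile l r (k + 1)) = (1 / 2 : ℝ) • secondDiff (profile l r) k := by
  rw [← idealGenerator_occ l r ⟨k, hk⟩]
  exact congrArg _ (funext fun η => profile_site l r ⟨k, hk⟩ η)

end Profile

section StateProfile

variable {n M : ℕ}

/-- The density profile as a sequence of observables of the process with finite reservoirs: the
occupation numbers at the sites `1, …, n + 1`, extended by the current reservoir densities. -/
noncomputable def stateProfile (k : ℕ) (ω : State n M) : ℝ :=
  profile (leftDensity ω) (rightDensity ω) k ω.1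

theorem stateProfile_last (ω : State n M) : stateProfile (n + 2) ω = rightDensity ω :=
  profile_last _ _ ω.1

theorem stateProfile_site (x : Fin (n + 1)) (ω : State n M) :
    stateProfile (x + 1) ω = occ ω.1 x :=
  profile_site _ _ x ω.1

theorem density_mem_Icc (k : Fin (M + 1)) : ((k : ℕ) : ℝ) / M ∈ Set.Icc (0 : ℝ) 1 :=
  ⟨by positivity, div_le_one_of_le₀ (by exact_mod_cast Fin.is_le k) (by positivity)⟩

theorem stateProfile_mem_Icc (k : ℕ) (ω : State n M) : stateProfile k ω ∈ Set.Icc (0 : ℝ) 1 :=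
  profile_mem_Icc (density_mem_Icc ω.2.1) (density_mem_Icc ω.2.2) k ω.1

theorem reservoirGenerator_comp_fst (f : Config n → ℝ) (ω : State n M) :
    reservoirGenerator n M (fun ω => f ω.1) ω
      = idealGenerator n (leftDensity ω) (rightDensity ω) f ω.1 :=
  rfl

theorem reservoirGenerator_stateProfile {k : ℕ} (hk : k < n + 1) :
    reservoirGenerator n M (stateProfile (k + 1)) = (1 / 2 : ℝ) • secondDiff stateProfile k := by
  funext ω
  have hocc : (stateProfile (k + 1) : State n M → ℝ) = fun ω => occ ω.1 ⟨k, hk⟩ :=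
    funext (stateProfile_site ⟨k, hk⟩)
  rw [hocc, reservoirGenerator_comp_fst fun η => occ η ⟨k, hk⟩, idealGenerator_occ]
  rfl

theorem boundaryRate_mul_reservoirUpdate_sub (hM : 0 < M) (b : Bool) (k : Fin (M + 1)) :
    boundaryRate ((k : ℕ) / M) (if b then 1 else 0)
        * (((reservoirUpdate b k : Fin (M + 1)) : ℕ) - (k : ℕ) : ℝ)
      = 1 / 2 * ((if b then 1 else 0) - (k : ℕ) / M) := by
  have hM' : (M : ℝ) ≠ 0 := by positivity
  cases b with
  | true =>
    rcases (Fin.is_le k).eq_or_lt with h | h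
    · simp [boundaryRate, reservoirUpdate, h, hM']
    · have : min M ((k : ℕ) + 1) = k + 1 := min_eq_right h
      simp [boundaryRate, reservoirUpdate, this]
  | false =>
    rcases Nat.eq_zero_or_pos (k : ℕ) with h | h
    · simp [boundaryRate, reservoirUpdate, h]
    · simp [boundaryRate, reservoirUpdate, Nat.cast_sub h]

theorem mul_reservoirGenerator_leftDensity (hM : 0 < M) (ω : State n M) :
    M * reservoirGenerator n M (stateProfile 0) ω
      = 1 / 2 * (stateProfile 1 ω - stateProfile 0 ω) := by
  have hM' : (M : ℝ) ≠ 0 := by positivity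
  have hgen : reservoirGenerator n M (stateProfile 0) ω = boundaryRate (leftDensity ω)
      (occ ω.1 0) * (leftDensity (leftMove ω) - leftDensity ω) := by
    simp [reservoirGenerator, stateProfile, profile, leftDensity, rightMove]
  have hocc : stateProfile 1 ω = occ ω.1 0 := stateProfile_site 0 ω
  rw [hgen, mul_left_comm, hocc, mul_sub]
  simp only [leftDensity, leftMove, mul_div_cancel₀ _ hM']
  exact boundaryRate_mul_reservoirUpdate_sub hM (ω.1 0) ω.2.1

theorem mul_reservoirGenerator_rightDensity (hM : 0 < M) (ω : State n M) :
    M * reservoirGenerator n M (stateProfile (n + 2)) ω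
      = 1 / 2 * (stateProfile (n + 1) ω - stateProfile (n + 2) ω) := by
  have hM' : (M : ℝ) ≠ 0 := by positivity
  have hdensity : (stateProfile (n + 2) : State n M → ℝ) = rightDensity := funext stateProfile_last
  have hgen : reservoirGenerator n M rightDensity ω = boundaryRate (rightDensity ω)
      (occ ω.1 (Fin.last n)) * (rightDensity (rightMove ω) - rightDensity ω) := by
    simp [reservoirGenerator, rightDensity, leftMove]
  have hocc : stateProfile (n + 1) ω = occ ω.1 (Fin.last n) := stateProfile_site (Fin.last n) ω
  rw [hdensity, hgen, mul_left_comm, hocc, mul_sub]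
  simp only [rightDensity, rightMove, mul_div_cancel₀ _ hM']
  exact boundaryRate_mul_reservoirUpdate_sub hM (ω.1 (Fin.last n)) ω.2.2

/-- The number of particles in the channel, a particle at the site `k` being counted with weight
`c k`. -/
noncomputable def channelMass (c : ℕ → ℝ) : State n M → ℝ :=
  ∑ k ∈ Finset.range (n + 1), c (k + 1) • stateProfile (k + 1)

/-- The number of particles in the channel and the reservoirs, a particle at the site `k` being
counted with weight `c k`, where the left and right reservoirs are located at `0` and `n + 2`. -/
noncomputable def weightedMass (c : ℕ → ℝ) : State n M → ℝ :=
  (M : ℝ) • (c 0 • stateProfile 0 + c (n + 2) • stateProfile (n + 2)) + channelMass c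

theorem channelMass_mem_Icc {c : ℕ → ℝ} (hc : ∀ k < n + 1, c (k + 1) ∈ Set.Icc (0 : ℝ) 1)
    (ω : State n M) : channelMass c ω ∈ Set.Icc (0 : ℝ) (n + 1) := by
  have hterm : ∀ k ∈ Finset.range (n + 1), c (k + 1) * stateProfile (k + 1) ω ∈ Set.Icc (0 : ℝ) 1 :=
    fun k hk => unitInterval.mul_mem (hc k (Finset.mem_range.1 hk)) (stateProfile_mem_Icc _ _)
  simp only [channelMass, Finset.sum_apply, Pi.smul_apply, smul_eq_mul]
  refine ⟨Finset.sum_nonneg fun k hk => (hterm k hk).1, ?_⟩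
  simpa using Finset.sum_le_card_nsmul _ _ 1 fun k hk => (hterm k hk).2

theorem reservoirGenerator_channelMass (p q : ℝ) (ω : State n M) :
    reservoirGenerator n M (channelMass fun k => p + q * k) ω
      = 1 / 2 * ((p + q * (n + 1)) * stateProfile (n + 2) ω
        - (p + q * (n + 2)) * stateProfile (n + 1) ω
        - p * stateProfile 1 ω + (p + q) * stateProfile 0 ω) := by
  have hsite : ∀ k ∈ Finset.range (n + 1),
      (p + q * ((k + 1 : ℕ) : ℝ)) * reservoirGenerator n M (stateProfile (k + 1)) ω
        = 1 / 2 * ((p + q * (k + 1)) * secondDiff (fun j => stateProfile j ω) k) := fun k hk => by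
    rw [reservoirGenerator_stateProfile (Finset.mem_range.1 hk)]
    simp only [Pi.smul_apply, Pi.sub_apply, smul_eq_mul, secondDiff]
    push_cast
    ring
  simp only [channelMass, map_sum, map_smul, Finset.sum_apply, Pi.smul_apply, smul_eq_mul]
  rw [Finset.sum_congr rfl hsite, ← Finset.mul_sum, sum_affine_mul_secondDiff]
  push_cast
  ring

theorem reservoirGenerator_weightedMass (hM : 0 < M) (p q : ℝ) (ω : State n M) :
    reservoirGenerator n M (weightedMass fun k => p + q * k) ω
      = q / 2 * (stateProfile 0 ω - stateProfile (n + 2) ω) := by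
  simp only [weightedMass, map_add, map_smul, Pi.add_apply, Pi.smul_apply, smul_eq_mul,
    reservoirGenerator_channelMass]
  push_cast
  linear_combination p * mul_reservoirGenerator_leftDensity hM ω
    + (p + q * (n + 2)) * mul_reservoirGenerator_rightDensity hM ω

end StateProfile

/-! ### Comparison of the two processes -/

theorem IsMarkovProcess.hasDerivAt_mean_of_secondDiff {Ω S : Type*} [MeasurableSpace Ω]
    [Fintype S] [MeasurableSpace S] [MeasurableSingletonClass S] {L : (S → ℝ) →ₗ[ℝ] (S → ℝ)}
    {P : Measure Ω} [IsFiniteMeasure P] {X : ℝ≥0 → Ω → S} (hX : IsMarkovProcess L P X) {D : ℝ}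
    {f : ℕ → S → ℝ} {k : ℕ} (hf : L (f (k + 1)) = D • secondDiff f k) (t : ℝ) :
    HasDerivAt (fun s => hX.mean s (f (k + 1)))
      (D * secondDiff (fun j => hX.mean t (f j)) k) t := by
  rw [← map_secondDiff, ← smul_eq_mul, ← map_smul, ← hf]
  exact hX.hasDerivAt_mean (f (k + 1)) t

section Comparison

variable {Ω : Type*} [MeasurableSpace Ω] {n M : ℕ} {P : Measure Ω} [IsProbabilityMeasure P]
  {X : ℝ≥0 → Ω → State n M}

theorem mul_abs_weighted_mean_density_sub_le (hM : 0 < M)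
    (hX : IsMarkovProcess (reservoirGenerator n M) P X) {p q : ℝ}
    (hpq : ∀ k < n + 1, p + q * ((k + 1 : ℕ) : ℝ) ∈ Set.Icc (0 : ℝ) 1) {t : ℝ} (ht : 0 ≤ t) :
    M * |p * (hX.mean t (stateProfile 0) - hX.mean 0 (stateProfile 0))
        + (p + q * (n + 2)) *
          (hX.mean t (stateProfile (n + 2)) - hX.mean 0 (stateProfile (n + 2)))|
      ≤ (n + 1) + |q| / 2 * t := by
  have hdrift : ∀ ω, |reservoirGenerator n M (weightedMass fun k => p + q * k) ω| ≤ |q| / 2 := by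
    intro ω
    have hleft := stateProfile_mem_Icc 0 ω
    have hright := stateProfile_mem_Icc (n + 2) ω
    rw [reservoirGenerator_weightedMass hM, abs_mul, abs_div, abs_two]
    exact mul_le_of_le_one_right (by positivity)
      (abs_le.2 ⟨by linarith [hleft.1, hright.2], by linarith [hleft.2, hright.1]⟩)
  have hmass := abs_le.1 (hX.abs_mean_sub_mean_zero_le hdrift ht)
  have hchannel : ∀ s, 0 ≤ s →
      hX.mean s (channelMass fun k => p + q * k) ∈ Set.Icc (0 : ℝ) (n + 1) :=
    fun s hs => hX.mean_mem_Icc (channelMass_mem_Icc hpq) hs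
  have hinit := hchannel 0 le_rfl
  have hfinal := hchannel t ht
  simp only [weightedMass, map_add, map_smul, smul_eq_mul, Nat.cast_zero, mul_zero, add_zero,
    Nat.cast_add, Nat.cast_ofNat] at hmass
  have habs : ∀ y : ℝ, M * |y| = |M * y| := fun y => by rw [abs_mul, Nat.abs_cast]
  rw [habs, abs_le]
  constructor <;> linarith [hmass.1, hmass.2, hinit.1, hinit.2, hfinal.1, hfinal.2]

theorem one_div_mul_succ_mem_Icc {k : ℕ} (hk : k < n + 1) :
    1 / ((n : ℝ) + 2) * ((k + 1 : ℕ) : ℝ) ∈ Set.Icc (0 : ℝ) 1 := by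
  rw [one_div_mul_eq_div]
  exact ⟨by positivity, div_le_one_of_le₀ (by exact_mod_cast hk.trans (by lia)) (by positivity)⟩

theorem abs_slope_mul_le {q t : ℝ} (hq : |q| = 1 / ((n : ℝ) + 2)) (ht : 0 ≤ t) :
    |q| / 2 * t ≤ t / (n + 1) := by
  rw [hq, div_div, one_div_mul_eq_div]
  gcongr
  linarith

theorem abs_mean_leftDensity_sub_le (hM : 0 < M)
    (hX : IsMarkovProcess (reservoirGenerator n M) P X) {t : ℝ} (ht : 0 ≤ t) :
    |hX.mean t (stateProfile 0) - hX.mean 0 (stateProfile 0)| ≤ ((n + 1) + t / (n + 1)) / M := by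
  have hslope : |-(1 / ((n : ℝ) + 2))| = 1 / (n + 2) := by rw [abs_neg, abs_of_pos (by positivity)]
  have hweight : ∀ k < n + 1, 1 + -(1 / ((n : ℝ) + 2)) * ((k + 1 : ℕ) : ℝ) ∈ Set.Icc (0 : ℝ) 1 :=
    fun k hk => by
      rw [neg_mul, ← sub_eq_add_neg]
      exact Set.Icc.one_sub_mem (one_div_mul_succ_mem_Icc hk)
  have h := mul_abs_weighted_mean_density_sub_le hM hX hweight ht
  rw [neg_mul, one_div_mul_cancel (by positivity), add_neg_cancel, zero_mul, one_mul,
    add_zero] at h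
  exact (le_div_iff₀' (by positivity)).2 (h.trans (by gcongr; exact abs_slope_mul_le hslope ht))

theorem abs_mean_rightDensity_sub_le (hM : 0 < M)
    (hX : IsMarkovProcess (reservoirGenerator n M) P X) {t : ℝ} (ht : 0 ≤ t) :
    |hX.mean t (stateProfile (n + 2)) - hX.mean 0 (stateProfile (n + 2))|
      ≤ ((n + 1) + t / (n + 1)) / M := by
  have hslope : |1 / ((n : ℝ) + 2)| = 1 / (n + 2) := abs_of_pos (by positivity)
  have h := mul_abs_weighted_mean_density_sub_le (p := 0) hM hX
    (fun k hk => by rw [zero_add]; exact one_div_mul_succ_mem_Icc hk) ht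
  rw [one_div_mul_cancel (by positivity), zero_mul, zero_add, zero_add, one_mul] at h
  exact (le_div_iff₀' (by positivity)).2 (h.trans (by gcongr; exact abs_slope_mul_le hslope ht))

variable {Ω' : Type*} [MeasurableSpace Ω'] {Q : Measure Ω'} [IsProbabilityMeasure Q]
  {Y : ℝ≥0 → Ω' → Config n} {vl vr : ℝ}

theorem abs_mean_stateProfile_sub_mean_profile_le
    (hX : IsMarkovProcess (reservoirGenerator n M) P X)
    (hY : IsMarkovProcess (idealGenerator n vl vr) Q Y) {B T : ℝ}
    (hleft : ∀ t ∈ Set.Icc 0 T, |hX.mean t (stateProfile 0) - vl| ≤ B)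
    (hright : ∀ t ∈ Set.Icc 0 T, |hX.mean t (stateProfile (n + 2)) - vr| ≤ B)
    (hinit : ∀ k < n + 1,
      |hX.mean 0 (stateProfile (k + 1)) - hY.mean 0 (profile vl vr (k + 1))| ≤ B)
    {k : ℕ} (hk : k < n + 1) {t : ℝ} (ht : t ∈ Set.Icc 0 T) :
    |hX.mean t (stateProfile (k + 1)) - hY.mean t (profile vl vr (k + 1))| ≤ B := by
  have hleft_const : ∀ s ∈ Set.Icc 0 T, hY.mean s (profile vl vr 0) = vl :=
    fun s hs => hY.mean_const vl hs.1
  have hright_const : ∀ s ∈ Set.Icc 0 T, hY.mean s (profile vl vr (n + 2)) = vr := fun s hs => by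
    rw [funext (profile_last vl vr), hY.mean_const vr hs.1]
  refine abs_heat_le_of_boundary_le (D := 1 / 2) (by norm_num)
    (w := fun k s => hX.mean s (stateProfile k) - hY.mean s (profile vl vr k))
    (fun k hk s _ => ?_) (fun s hs => by rw [hleft_const s hs]; exact hleft s hs)
    (fun s hs => by rw [hright_const s hs]; exact hright s hs) hinit hk ht
  refine ((hX.hasDerivAt_mean_of_secondDiff (reservoirGenerator_stateProfile hk) s).sub
    (hY.hasDerivAt_mean_of_secondDiff (idealGenerator_profile vl vr hk) s)).hasDerivWithinAt
    |>.congr_deriv ?_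
  simp only [secondDiff]
  ring

theorem abs_integral_occ_sub_le (hM : 0 < M)
    (hX : IsMarkovProcess (reservoirGenerator n M) P X)
    (hY : IsMarkovProcess (idealGenerator n vl vr) Q Y)
    (hinit : ∀ x, ∫ ω, occ (X 0 ω).1 x ∂P = ∫ ω, occ (Y 0 ω) x ∂Q) (x : Fin (n + 1)) (t : ℝ≥0) :
    |∫ ω, occ (X t ω).1 x ∂P - ∫ ω, occ (Y t ω) x ∂Q|
      ≤ |∫ ω, leftDensity (X 0 ω) ∂P - vl| + |∫ ω, rightDensity (X 0 ω) ∂P - vr|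
        + ((n + 1) + t / (n + 1)) / M := by
  have hoccX (x : Fin (n + 1)) (s : ℝ≥0) :
      ∫ ω, occ (X s ω).1 x ∂P = hX.mean s (stateProfile (x + 1)) := by
    simp only [← hX.integral_eq_mean, stateProfile_site]
  have hoccY (x : Fin (n + 1)) (s : ℝ≥0) :
      ∫ ω, occ (Y s ω) x ∂Q = hY.mean s (profile vl vr (x + 1)) := by
    simp only [← hY.integral_eq_mean, profile_site]
  have hleft : ∫ ω, leftDensity (X 0 ω) ∂P = hX.mean 0 (stateProfile 0) :=
    hX.integral_eq_mean leftDensity 0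
  have hright : ∫ ω, rightDensity (X 0 ω) ∂P = hX.mean 0 (stateProfile (n + 2)) := by
    rw [funext stateProfile_last]
    exact hX.integral_eq_mean rightDensity 0
  have hdrift : ∀ s ≤ (t : ℝ), ((n + 1) + s / (n + 1)) / M ≤ ((n + 1) + t / (n + 1)) / (M : ℝ) :=
    fun s hs => by gcongr
  rw [hoccX, hoccY, hleft, hright]
  refine abs_mean_stateProfile_sub_mean_profile_le hX hY (fun s hs => ?_) (fun s hs => ?_)
    (fun k hk => ?_) x.2 (Set.right_mem_Icc.2 t.2)
  · linarith [hdrift s hs.2, abs_mean_leftDensity_sub_le hM hX hs.1,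
      abs_sub_le (hX.mean s (stateProfile 0)) (hX.mean 0 (stateProfile 0)) vl,
      abs_nonneg (hX.mean 0 (stateProfile (n + 2)) - vr)]
  · linarith [hdrift s hs.2, abs_mean_rightDensity_sub_le hM hX hs.1,
      abs_sub_le (hX.mean s (stateProfile (n + 2))) (hX.mean 0 (stateProfile (n + 2))) vr,
      abs_nonneg (hX.mean 0 (stateProfile 0) - vl)]
  · have h := (hoccX ⟨k, hk⟩ 0).symm.trans ((hinit ⟨k, hk⟩).trans (hoccY ⟨k, hk⟩ 0))
    rw [← NNReal.coe_zero, h, sub_self, abs_zero]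
    positivity

end Comparison

/-! ### The limit -/

section ConvergenceOfMeans

variable {E : Type*} [NormedAddCommGroup E] [NormedSpace ℝ E]

theorem norm_integral_le_add_mul_measureReal {Ω : Type*} [MeasurableSpace Ω] {μ : Measure Ω}
    [IsProbabilityMeasure μ] {f : Ω → E} (hf : AEStronglyMeasurable f μ) {K δ : ℝ}
    (hK : ∀ ω, ‖f ω‖ ≤ K) (hδ : 0 ≤ δ) :
    ‖∫ ω, f ω ∂μ‖ ≤ δ + K * μ.real {ω | δ ≤ ‖f ω‖} := by
  have hs : NullMeasurableSet {ω | δ ≤ ‖f ω‖} μ :=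
    nullMeasurableSet_le aemeasurable_const hf.norm.aemeasurable
  have hi : Integrable ({ω | δ ≤ ‖f ω‖}.indicator fun _ => K) μ :=
    (integrable_const K).indicator₀ hs
  have hbound (ω : Ω) : ‖f ω‖ ≤ δ + {ω | δ ≤ ‖f ω‖}.indicator (fun _ => K) ω := by
    by_cases h : δ ≤ ‖f ω‖
    · simpa [h] using (hK ω).trans (le_add_of_nonneg_left hδ)
    · simpa [h] using (not_le.1 h).le
  calc ‖∫ ω, f ω ∂μ‖ ≤ ∫ ω, δ + {ω | δ ≤ ‖f ω‖}.indicator (fun _ => K) ω ∂μ :=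
        norm_integral_le_of_norm_le ((integrable_const δ).add hi) (.of_forall hbound)
    _ = δ + K * μ.real {ω | δ ≤ ‖f ω‖} := by
        rw [integral_add (integrable_const δ) hi, integral_indicator₀ hs, integral_const,
          setIntegral_const, probReal_univ, one_smul, smul_eq_mul, mul_comm]

theorem tendsto_integral_of_tendsto_measure [CompleteSpace E] {ι : Type*} {l : Filter ι}
    {Ω : ι → Type*} [∀ i, MeasurableSpace (Ω i)] {P : ∀ i, Measure (Ω i)}
    [∀ i, IsProbabilityMeasure (P i)] {Z : ∀ i, Ω i → E} {v : E} {K : ℝ}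
    (hZ : ∀ i, AEStronglyMeasurable (Z i) (P i)) (hK : ∀ i ω, ‖Z i ω‖ ≤ K)
    (hconv : ∀ δ : ℝ, 0 < δ → Tendsto (fun i => P i {ω | δ ≤ ‖Z i ω - v‖}) l (𝓝 0)) :
    Tendsto (fun i => ∫ ω, Z i ω ∂(P i)) l (𝓝 v) := by
  rw [tendsto_iff_norm_sub_tendsto_zero]
  refine tendsto_order.2 ⟨fun a ha => .of_forall fun i => ha.trans_le (norm_nonneg _),
    fun ε hε => ?_⟩
  have hreal : Tendsto (fun i => (K + ‖v‖) * (P i).real {ω | ε / 2 ≤ ‖Z i ω - v‖}) l (𝓝 0) := by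
    simpa [measureReal_def] using ((ENNReal.tendsto_toReal ENNReal.zero_ne_top).comp
      (hconv (ε / 2) (half_pos hε))).const_mul (K + ‖v‖)
  filter_upwards [hreal.eventually_lt_const (half_pos hε)] with i hi
  have hsub : ∫ ω, Z i ω ∂(P i) - v = ∫ ω, Z i ω - v ∂(P i) := by
    rw [integral_sub (.of_bound (hZ i) K (.of_forall (hK i))) (integrable_const v),
      integral_const, probReal_univ, one_smul]
  calc ‖∫ ω, Z i ω ∂(P i) - v‖
      ≤ ε / 2 + (K + ‖v‖) * (P i).real {ω | ε / 2 ≤ ‖Z i ω - v‖} := by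
        rw [hsub]
        exact norm_integral_le_add_mul_measureReal ((hZ i).sub aestronglyMeasurable_const)
          (fun ω => (norm_sub_le _ _).trans (by gcongr; exact hK i ω)) (half_pos hε).le
    _ < ε := by linarith

theorem tendsto_integral_comp_of_tendsto_measure {ι : Type*} {l : Filter ι} {Ω S : ι → Type*}
    [∀ i, MeasurableSpace (Ω i)] [∀ i, Finite (S i)] [∀ i, MeasurableSpace (S i)]
    [∀ i, MeasurableSingletonClass (S i)] {P : ∀ i, Measure (Ω i)} [∀ i, IsProbabilityMeasure (P i)]
    {Z : ∀ i, Ω i → S i} (hZ : ∀ i, Measurable (Z i)) {f : ∀ i, S i → ℝ}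
    (hf : ∀ i s, f i s ∈ Set.Icc (0 : ℝ) 1) {v : ℝ}
    (hconv : ∀ δ : ℝ, 0 < δ → Tendsto (fun i => P i {ω | δ ≤ |f i (Z i ω) - v|}) l (𝓝 0)) :
    Tendsto (fun i => ∫ ω, f i (Z i ω) ∂(P i)) l (𝓝 v) :=
  tendsto_integral_of_tendsto_measure
    (fun i => (integrable_comp_of_finite (hZ i) (f i)).aestronglyMeasurable)
    (fun i _ => abs_le.2 ⟨neg_one_lt_zero.le.trans (hf i _).1, (hf i _).2⟩) hconv

end ConvergenceOfMeans

section Scales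

open Asymptotics

theorem isLittleO_rpow_rpow_atTop {a b : ℝ} (hab : a < b) :
    (fun x : ℝ => x ^ a) =o[atTop] fun x => x ^ b := by
  refine isLittleO_of_tendsto' ?_ ?_
  · filter_upwards [eventually_gt_atTop 0] with x hx h
    exact absurd h (Real.rpow_pos_of_pos hx b).ne'
  · refine (tendsto_rpow_neg_atTop (sub_pos.2 hab)).congr' ?_
    filter_upwards [eventually_gt_atTop 0] with x hx
    rw [neg_sub, Real.rpow_sub hx]

theorem isEquivalent_of_abs_sub_le {ι : Type*} {l : Filter ι} {f g : ι → ℝ} {C : ℝ}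
    (h : ∀ i, |f i - g i| ≤ C) (hg : Tendsto g l atTop) : f ~[l] g := by
  have hbounded : (f - g) =O[l] fun _ => (1 : ℝ) :=
    .of_bound C (.of_forall fun i => by simpa using h i)
  exact hbounded.trans_isLittleO
    ((isLittleO_one_left_iff ℝ).2 (tendsto_norm_atTop_atTop.comp hg))

theorem tendsto_natCast_succ_atTop : Tendsto (fun n : ℕ => ((n + 1 : ℕ) : ℝ)) atTop atTop :=
  tendsto_natCast_atTop_atTop.comp (tendsto_add_atTop_nat 1)

variable {α : ℝ} {M : ℕ → ℕ}

theorem isEquivalent_reservoirSize (hα : 0 < 1 + α)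
    (hM : ∀ n : ℕ, |(M n : ℝ) - ((n + 1 : ℕ) : ℝ) ^ (1 + α)| < 1) :
    (fun n => (M n : ℝ)) ~[atTop] fun n => ((n + 1 : ℕ) : ℝ) ^ (1 + α) :=
  isEquivalent_of_abs_sub_le (fun n => (hM n).le)
    ((tendsto_rpow_atTop hα).comp tendsto_natCast_succ_atTop)

theorem succ_isLittleO_reservoirSize (hα : 0 < α)
    (hM : ∀ n : ℕ, |(M n : ℝ) - ((n + 1 : ℕ) : ℝ) ^ (1 + α)| < 1) :
    (fun n : ℕ => ((n + 1 : ℕ) : ℝ)) =o[atTop] fun n => (M n : ℝ) := by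
  have h := (isLittleO_rpow_rpow_atTop (lt_add_of_pos_right 1 hα)).comp_tendsto
    tendsto_natCast_succ_atTop
  simp only [Function.comp_def, Real.rpow_one] at h
  exact h.trans_isEquivalent (isEquivalent_reservoirSize (by positivity) hM).symm

theorem rpow_isLittleO_succ_mul_reservoirSize (hα : 0 < 1 + α)
    (hM : ∀ n : ℕ, |(M n : ℝ) - ((n + 1 : ℕ) : ℝ) ^ (1 + α)| < 1) {α' : ℝ} (hα' : α' < α) :
    (fun n : ℕ => ((n + 1 : ℕ) : ℝ) ^ (2 + α')) =o[atTop]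
      fun n => ((n + 1 : ℕ) : ℝ) * (M n : ℝ) := by
  have hlt : 2 + α' < 1 + (1 + α) := by linarith
  have h := (isLittleO_rpow_rpow_atTop hlt).comp_tendsto tendsto_natCast_succ_atTop
  have hrpow (n : ℕ) : ((n + 1 : ℕ) : ℝ) ^ (1 + (1 + α))
      = ((n + 1 : ℕ) : ℝ) * ((n + 1 : ℕ) : ℝ) ^ (1 + α) := by
    rw [Real.rpow_add (by positivity), Real.rpow_one]
  simp only [Function.comp_def, hrpow] at h
  exact h.trans_isEquivalent (IsEquivalent.refl.mul (isEquivalent_reservoirSize hα hM).symm)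

end Scales

theorem theorem3p1_general (M : ℕ → ℕ) (θ : ℕ → ℝ≥0)
    (hNM : (fun n : ℕ => ((n + 1 : ℕ) : ℝ)) =o[atTop] fun n => (M n : ℝ))
    (hθ : (fun n : ℕ => (θ n : ℝ)) =o[atTop] fun n => ((n + 1 : ℕ) : ℝ) * M n)
    (vl vr : ℝ)
    {Ω : ℕ → Type*} [∀ n, MeasurableSpace (Ω n)]
    (P : ∀ n, Measure (Ω n)) [∀ n, IsProbabilityMeasure (P n)]
    (X : ∀ n, ℝ≥0 → Ω n → State n (M n))
    (hX : ∀ n, IsMarkovProcess (reservoirGenerator n (M n)) (P n) (X n))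
    (hleft : Tendsto (fun n => ∫ ω, leftDensity (X n 0 ω) ∂(P n)) atTop (𝓝 vl))
    (hright : Tendsto (fun n => ∫ ω, rightDensity (X n 0 ω) ∂(P n)) atTop (𝓝 vr))
    {Ω' : ℕ → Type*} [∀ n, MeasurableSpace (Ω' n)]
    (Q : ∀ n, Measure (Ω' n)) [∀ n, IsProbabilityMeasure (Q n)]
    (Y : ∀ n, ℝ≥0 → Ω' n → Config n)
    (hY : ∀ n, IsMarkovProcess (idealGenerator n vl vr) (Q n) (Y n))
    (hinit : ∀ (n : ℕ) (x : Fin (n + 1)),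
      ∫ ω, occ (X n 0 ω).1 x ∂(P n) = ∫ ω, occ (Y n 0 ω) x ∂(Q n)) (T : ℝ≥0) :
    Tendsto
      (fun n : ℕ => ⨆ x : Fin (n + 1), ⨆ t : Set.Icc (0 : ℝ≥0) T,
        |(∫ ω, occ (X n (θ n * t) ω).1 x ∂(P n)) - ∫ ω, occ (Y n (θ n * t) ω) x ∂(Q n)|)
      atTop (𝓝 0) := by
  have hM : ∀ᶠ n in atTop, 0 < M n := by
    filter_upwards [hNM.def one_pos] with n hn
    simp only [Real.norm_natCast, one_mul, Nat.cast_le] at hn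
    exact n.succ_pos.trans_le hn
  have hbound : Tendsto (fun n => |∫ ω, leftDensity (X n 0 ω) ∂(P n) - vl|
      + |∫ ω, rightDensity (X n 0 ω) ∂(P n) - vr|
      + (((n + 1 : ℕ) : ℝ) / M n + T * (θ n / (((n + 1 : ℕ) : ℝ) * M n)))) atTop (𝓝 0) := by
    simpa using ((tendsto_iff_norm_sub_tendsto_zero.1 hleft).add
      (tendsto_iff_norm_sub_tendsto_zero.1 hright)).add
      (hNM.tendsto_div_nhds_zero.add (hθ.tendsto_div_nhds_zero.const_mul (T : ℝ)))
  refine squeeze_zero' (.of_forall fun n => Real.iSup_nonneg fun x => Real.iSup_nonneg fun t =>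
    abs_nonneg _) ?_ hbound
  filter_upwards [hM] with n hMn
  refine Real.iSup_le (fun x => Real.iSup_le (fun t => ?_) (by positivity)) (by positivity)
  have ht : ((t : ℝ≥0) : ℝ) ≤ T := t.2.2
  have hdrift : (((n : ℝ) + 1) + (θ n * t : ℝ≥0) / (n + 1)) / M n
      ≤ ((n + 1 : ℕ) : ℝ) / M n + T * (θ n / (((n + 1 : ℕ) : ℝ) * M n)) :=
    calc (((n : ℝ) + 1) + (θ n * t : ℝ≥0) / (n + 1)) / M n
        ≤ (((n : ℝ) + 1) + θ n * T / (n + 1)) / M n := by push_cast; gcongr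
      _ = _ := by push_cast; field_simp
  exact (abs_integral_occ_sub_le hMn (hX n) (hY n) (hinit n) x (θ n * t)).trans (by gcongr)

/-- Ideal reservoir limit. The index `n` corresponds to the channel size `N = n + 1`; under `P n` the
process `X n` is the exclusion process coupled to two reservoirs of size `M n ≈ N ^ (1 + α)`, and
under `Q n` the process `Y n` is the exclusion process with ideal reservoirs. -/
theorem theorem3p1
    (α : ℝ) (hα : 0 < α)
    -- the reservoir size is the integer `N ^ (1 + α)`, up to rounding
    (M : ℕ → ℕ) (hM : ∀ n : ℕ, |(M n : ℝ) - ((n + 1 : ℕ) : ℝ) ^ (1 + α)| < 1)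
    (u₀ : ℝ → ℝ) (hu₀ : ContinuousOn u₀ (Set.Ioo 0 1))
    (hu₀' : ∀ r ∈ Set.Ioc (0 : ℝ) 1, u₀ r ∈ Set.Icc (0 : ℝ) 1)
    (vl vr : ℝ) (hvl : vl ∈ Set.Icc (0 : ℝ) 1) (hvr : vr ∈ Set.Icc (0 : ℝ) 1)
    -- the process with finite reservoirs
    {Ω : ℕ → Type*} [∀ n, MeasurableSpace (Ω n)]
    (P : ∀ n, Measure (Ω n)) [∀ n, IsProbabilityMeasure (P n)]
    (X : ∀ n, ℝ≥0 → Ω n → State n (M n))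
    (hX : ∀ n, IsMarkovProcess (reservoirGenerator n (M n)) (P n) (X n))
    -- initial condition: reservoir densities converge in probability, channel has profile `u₀`
    (hleft : ∀ δ : ℝ, 0 < δ →
      Tendsto (fun n => P n {ω | δ ≤ |leftDensity (X n 0 ω) - vl|}) atTop (𝓝 0))
    (hright : ∀ δ : ℝ, 0 < δ →
      Tendsto (fun n => P n {ω | δ ≤ |rightDensity (X n 0 ω) - vr|}) atTop (𝓝 0))
    (hX0 : ∀ (n : ℕ) (x : Fin (n + 1)),
      ∫ ω, occ (X n 0 ω).1 x ∂(P n) = u₀ (((x : ℕ) + 1 : ℝ) / ((n + 1 : ℕ) : ℝ)))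
    -- the process with ideal reservoirs, started from the same density profile
    {Ω' : ℕ → Type*} [∀ n, MeasurableSpace (Ω' n)]
    (Q : ∀ n, Measure (Ω' n)) [∀ n, IsProbabilityMeasure (Q n)]
    (Y : ∀ n, ℝ≥0 → Ω' n → Config n)
    (hY : ∀ n, IsMarkovProcess (idealGenerator n vl vr) (Q n) (Y n))
    (hY0 : ∀ (n : ℕ) (x : Fin (n + 1)),
      ∫ ω, occ (Y n 0 ω) x ∂(Q n) = u₀ (((x : ℕ) + 1 : ℝ) / ((n + 1 : ℕ) : ℝ))) :
    ∀ α' : ℝ, 0 ≤ α' → α' < α → ∀ T : ℝ≥0, 0 < T →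
      Tendsto
        (fun n : ℕ => ⨆ x : Fin (n + 1), ⨆ t : Set.Icc (0 : ℝ≥0) T,
          |(∫ ω, occ (X n (((n + 1 : ℕ) : ℝ≥0) ^ (2 + α') * t) ω).1 x ∂(P n))
            - ∫ ω, occ (Y n (((n + 1 : ℕ) : ℝ≥0) ^ (2 + α') * t) ω) x ∂(Q n)|)
        atTop (𝓝 0) := by
  intro α' _ hα' T _
  exact theorem3p1_general M _ (succ_isLittleO_reservoirSize hα hM)
    (by simpa using rpow_isLittleO_succ_mul_reservoirSize (by positivity) hM hα') vl vr P X hX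
    (tendsto_integral_comp_of_tendsto_measure (fun n => (hX n).measurable 0)
      (fun n ω => density_mem_Icc ω.2.1) hleft)
    (tendsto_integral_comp_of_tendsto_measure (fun n => (hX n).measurable 0)
      (fun n ω => density_mem_Icc ω.2.2) hright)
    Q Y hY (fun n x => (hX0 n x).trans (hY0 n x).symm) T
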